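/- For a finite-dimensional bipartite system with Hilbert space $\mathcal H=\mathcal H_A\otimes\mathcal H_B$, a state is a positive semidefinite operator of trace one on $\mathcal H$; it is separable if it is a convex combination of products of states on $\mathcal H_A$ and on $\mathcal H_B$, and entangled otherwise. Let $\phi_2=\tfrac12\sum_{i,j=0}^{1}|i,i\rangle\langle j,j|$ on $\mathbb C^2\otimes\mathbb C^2$, and define the SLOCC singlet fraction $$F_2(\rho)=\sup_{A,B}\frac{\operatorname{tr}[(A\otimes B)^\dagger\rho(A\otimes B)\,\phi_2]}{\operatorname{tr}[(A\otimes B)^\dagger\rho(A\otimes B)]},$$ where the supremum is over all linear maps $A:\mathbb C^2\to\mathcal H_A$, $B:\mathbb C^2\to\mathcal H_B$ with non-zero denominator. A state $\sigma$ on $\mathcal H$ is called copy-correlated $k$-undistillable if there is a state $\omega$ on $\mathcal H^{\otimes k}$, invariant under conjugation by all permutations of the $k$ bipartite copies, whose partial trace over all copies but the first is $\sigma$, and which satisfies $F_2(\omega)=\tfrac12$ with respect to the bipartition $\mathcal H_A^{\otimes k}:\mathcal H_B^{\otimes k}$. Theorem. For every $d$, every entangled state $\rho$ on $\mathbb C^d\otimes\mathbb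 C^d$ and every integer $k\ge 1$, there is a copy-correlated $k$-undistillable state $\sigma$, on a bipartite system both of whose local Hilbert spaces are $\mathbb C^d\otimes\mathbb C^2\cong\mathbb C^{2d}$, such that the joint state $\rho\otimes\sigma$ is single-copy distillable, i.e. $F_2(\rho\otimes\sigma)>\tfrac12$, where each of the two parties holds its share of both systems. -/

import Mathlib

open scoped Kronecker ComplexOrder

namespace CopyCorr

noncomputable section

/-- Density matrices: positive semidefinite matrices of trace one.  The Hilbert space is `ℂ^ι`. -/
def IsState {ι : Type*} [Fintype ι] (ρ : Matrix ι ι ℂ) : Prop :=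
  ρ.PosSemidef ∧ ρ.trace = 1

/-- Separable (classically correlated) operators on `ℂ^α ⊗ ℂ^β`: convex combinations of products of
local states. -/
def IsSeparable {α β : Type*} [Fintype α] [Fintype β]
    (ρ : Matrix (α × β) (α × β) ℂ) : Prop :=
  ρ ∈ convexHull ℝ {τ : Matrix (α × β) (α × β) ℂ |
    ∃ (a : Matrix α α ℂ) (b : Matrix β β ℂ), IsState a ∧ IsState b ∧ τ = a ⊗ₖ b}

/-- Entangled states: bipartite states that are not separable. -/
def IsEntangled {α β : Type*} [Fintype α] [Fintype β]
    (ρ : Matrix (α × β) (α × β) ℂ) : Prop :=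
  IsState ρ ∧ ¬ IsSeparable ρ

/-- The projector `φ₂ = ½ ∑_{i,j} |i,i⟩⟨j,j|` onto the two-qubit maximally entangled state. -/
def phi2 : Matrix (Fin 2 × Fin 2) (Fin 2 × Fin 2) ℂ :=
  Matrix.of fun x y => if x.1 = x.2 ∧ y.1 = y.2 then 1 / 2 else 0

/-- The unnormalized two-qubit output `(A ⊗ B)† ρ (A ⊗ B)` of a local filter. -/
def filtered {α β : Type*} [Fintype α] [Fintype β] (ρ : Matrix (α × β) (α × β) ℂ)
    (A : Matrix α (Fin 2) ℂ) (B : Matrix β (Fin 2) ℂ) :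
    Matrix (Fin 2 × Fin 2) (Fin 2 × Fin 2) ℂ :=
  (A ⊗ₖ B).conjTranspose * ρ * (A ⊗ₖ B)

/-- The SLOCC singlet fraction `F₂(ρ)`: the supremum of
`tr[(A ⊗ B)† ρ (A ⊗ B) φ₂] / tr[(A ⊗ B)† ρ (A ⊗ B)]` over all local filters `A`, `B` that succeed
with non-zero probability. -/
def F2 {α β : Type*} [Fintype α] [Fintype β] (ρ : Matrix (α × β) (α × β) ℂ) : ℝ :=
  sSup {r : ℝ | ∃ (A : Matrix α (Fin 2) ℂ) (B : Matrix β (Fin 2) ℂ),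
    0 < (filtered ρ A B).trace.re ∧
      r = (filtered ρ A B * phi2).trace.re / (filtered ρ A B).trace.re}

/-- An operator on `k` copies of `ℂ^α ⊗ ℂ^β`, regarded as a bipartite operator: the first party
holds all the `α`-factors and the second party all the `β`-factors. -/
def asBipartite {α β : Type*} {k : ℕ} (ω : Matrix (Fin k → α × β) (Fin k → α × β) ℂ) :
    Matrix ((Fin k → α) × (Fin k → β)) ((Fin k → α) × (Fin k → β)) ℂ :=
  Matrix.reindex (Equiv.arrowProdEquivProdArrow (Fin k) (fun _ => α) (fun _ => β))
    (Equiv.arrowProdEquivProdArrow (Fin k) (fun _ => α) (fun _ => β)) ω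

/-- Invariance of an operator on `k` copies of `ℂ^γ` under conjugation with the unitaries that
permute the copies. -/
def IsPermSymmetric {γ : Type*} {k : ℕ} (ω : Matrix (Fin k → γ) (Fin k → γ) ℂ) : Prop :=
  ∀ π : Equiv.Perm (Fin k), ω.submatrix (fun x => x ∘ π) (fun x => x ∘ π) = ω

/-- The partial trace over all copies except the `m`-th one.  The index
`(Equiv.funSplitAt m γ).symm (i, z)` has entry `i` at copy `m` and entries `z` at the others. -/
def reduceTo {γ : Type*} [Fintype γ] {k : ℕ} (m : Fin k)
    (ω : Matrix (Fin k → γ) (Fin k → γ) ℂ) : Matrix γ γ ℂ :=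
  Matrix.of fun i j => ∑ z : {l : Fin k // l ≠ m} → γ,
    ω ((Equiv.funSplitAt m γ).symm (i, z)) ((Equiv.funSplitAt m γ).symm (j, z))

/-- Copy-correlated `k`-undistillable states: those with a permutation-symmetric extension to `k`
copies that is single-copy undistillable. -/
def IsCopyCorrelatedUndistillable {α β : Type*} [Fintype α] [Fintype β] (k : ℕ) [NeZero k]
    (σ : Matrix (α × β) (α × β) ℂ) : Prop :=
  IsState σ ∧ ∃ ω : Matrix (Fin k → α × β) (Fin k → α × β) ℂ,
    IsState ω ∧ IsPermSymmetric ω ∧ F2 (asBipartite ω) = 1 / 2 ∧ reduceTo (0 : Fin k) ω = σ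

/-- The joint state `ρ ⊗ σ` of two bipartite systems, regarded as a bipartite state: each party
holds its share of both systems. -/
def joint {α β α' β' : Type*} (ρ : Matrix (α × β) (α × β) ℂ)
    (σ : Matrix (α' × β') (α' × β') ℂ) :
    Matrix ((α × α') × (β × β')) ((α × α') × (β × β')) ℂ :=
  Matrix.reindex (Equiv.prodProdProdComm α β α' β') (Equiv.prodProdProdComm α β α' β') (ρ ⊗ₖ σ)

end

end CopyCorr

/-! A filter pair `A`, `B` witnesses `F2 M > 1/2` exactly when the trace minus twice the
`phi2`-overlap is negative. The partial transpose of `1 - 2 * phi2` is the rank-one form built from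
the antisymmetric vector, so this difference is the quadratic form `gap M` of the partial transpose
of `M`, evaluated at `cross A B`, a matrix of rank at most two (`gap_cross`).

Separable states form a closed convex set, so ρ has a strict witness K: negative on ρ, strictly
positive on product vectors. Put S = λ·1 ⊗ (1 - φ₂) + 3(λ·1 - K) ⊗ φ₂. Its λ-part has partial
transpose λ(1 + swap) on the qubits, which vanishes only on tensors antisymmetric in the qubits.
Such a tensor of rank at most two is a product u ⊗ v times the antisymmetric form
(`exists_product_of_minorsVanish`), and there the K-part is strictly positive. By compactness, a
large λ makes the gap nonnegative at every filter (`exists_companion_gap_nonneg`). If instead each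
party projects its share of ρ and of the first factor of S onto the maximally entangled vector, λ
cancels and the gap is 3 ∑ K ρ < 0 (`gap_joint_companion`).

For k copies, normalize S, place it at a uniformly random copy and put a product basis state |c⟩⟨c|
at all others. Fixing the other copies restricts a filter to a filter on S, so the extension has
nonnegative gap. Its one-copy marginal is a mixture of S and |c⟩⟨c|, and c is chosen so that |c⟩⟨c|
contributes nothing to the joint gap. -/

namespace CopyCorr

/-! ### Compactness of states and closedness of the separable set -/

/-- Carathéodory: in finite dimension the convex hull of a compact set is compact. -/
theorem isCompact_convexHull_of_isCompact {E : Type*} [AddCommGroup E] [Module ℝ E]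
    [TopologicalSpace E] [IsTopologicalAddGroup E] [ContinuousSMul ℝ E] [FiniteDimensional ℝ E]
    {s : Set E} (hs : IsCompact s) : IsCompact (convexHull ℝ s) := by
  have key : convexHull ℝ s = ⋃ n ∈ Finset.range (Module.finrank ℝ E + 2),
      (fun p : (Fin n → ℝ) × (Fin n → E) => ∑ i, p.1 i • p.2 i) ''
        (stdSimplex ℝ (Fin n) ×ˢ Set.univ.pi fun _ => s) := by
    apply Set.Subset.antisymm
    · intro x hx
      obtain ⟨ι, _, z, w, hz, hind, hw, hw1, hx⟩ := eq_pos_convex_span_of_mem_convexHull hx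
      have hcard : Fintype.card ι ≤ Module.finrank ℝ E + 1 :=
        hind.card_le_finrank_succ.trans (by gcongr; exact Submodule.finrank_le _)
      simp only [Set.mem_iUnion]
      refine ⟨Fintype.card ι, by simp; omega, ?_⟩
      let e := (Fintype.equivFin ι).symm
      refine ⟨(w ∘ e, z ∘ e), ⟨⟨fun i => (hw _).le, ?_⟩, fun i _ => hz ⟨e i, rfl⟩⟩, ?_⟩
      · simpa [hw1] using e.sum_comp w
      · simpa [hx] using e.sum_comp fun i => w i • z i
    · simp only [Set.iUnion_subset_iff, Set.image_subset_iff]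
      rintro n - ⟨w, z⟩ ⟨⟨hw, hw1⟩, hz⟩
      exact (convex_convexHull ℝ s).sum_mem (fun i _ => hw i) hw1
        fun i _ => subset_convexHull ℝ s (hz i trivial)
  rw [key]
  refine Finset.isCompact_biUnion _ fun n _ => IsCompact.image ?_ (by fun_prop)
  exact (isCompact_stdSimplex ℝ (Fin n)).prod (isCompact_univ_pi fun _ => hs)

open scoped MatrixOrder Matrix.Norms.L2Operator in
theorem exists_eq_mul_conjTranspose {ι : Type*} [Fintype ι] {M : Matrix ι ι ℂ}
    (hM : M.PosSemidef) : ∃ B : Matrix ι ι ℂ, M = B * B.conjTranspose := by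
  classical
  obtain ⟨B, hB⟩ := CStarAlgebra.nonneg_iff_eq_star_mul_self.mp hM.nonneg
  exact ⟨B.conjTranspose, by simpa [Matrix.star_eq_conjTranspose] using hB⟩

/-- States are the image of the compact Frobenius unit sphere under B ↦ B B†, since tr(B B†) is the
squared Frobenius norm. -/
theorem isCompact_setOf_isState (α : Type*) [Fintype α] :
    IsCompact {a : Matrix α α ℂ | IsState a} := by
  classical
  have hK : IsCompact {B : Matrix α α ℂ | ∑ i, ∑ j, ‖B i j‖ ^ 2 = 1} := by
    change IsCompact {B : α → α → ℂ | ∑ i, ∑ j, ‖B i j‖ ^ 2 = 1}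
    refine Metric.isCompact_of_isClosed_isBounded
      (isClosed_eq (by fun_prop) continuous_const) ?_
    refine (Metric.isBounded_closedBall (x := (0 : α → α → ℂ)) (r := 1)).subset fun B hB => ?_
    rw [mem_closedBall_zero_iff, pi_norm_le_iff_of_nonneg zero_le_one]
    intro i
    rw [pi_norm_le_iff_of_nonneg zero_le_one]
    intro j
    have h1 : ‖B i j‖ ^ 2 ≤ 1 := by
      rw [← Set.mem_ofPred.mp hB]
      exact (Finset.single_le_sum (f := fun j => ‖B i j‖ ^ 2) (fun _ _ => by positivity)
        (Finset.mem_univ j)).trans (Finset.single_le_sum (f := fun i => ∑ j, ‖B i j‖ ^ 2)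
          (fun _ _ => by positivity) (Finset.mem_univ i))
    nlinarith [norm_nonneg (B i j)]
  have htr : ∀ B : Matrix α α ℂ, (B * B.conjTranspose).trace
      = ((∑ i, ∑ j, ‖B i j‖ ^ 2 : ℝ) : ℂ) := by
    intro B
    simp [Matrix.trace, Matrix.mul_apply, Complex.mul_conj, Complex.normSq_eq_norm_sq]
  convert hK.image (f := fun B => B * B.conjTranspose) (by fun_prop) using 1
  ext a
  constructor
  · rintro ⟨ha, h1⟩
    obtain ⟨B, rfl⟩ := exists_eq_mul_conjTranspose ha
    refine ⟨B, ?_, rfl⟩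
    have := htr B
    rw [h1] at this
    exact_mod_cast this.symm
  · rintro ⟨B, hB, rfl⟩
    refine ⟨Matrix.posSemidef_self_mul_conjTranspose B, ?_⟩
    rw [htr, Set.mem_ofPred.mp hB]; simp

theorem isClosed_setOf_isSeparable (α β : Type*) [Fintype α] [Fintype β] :
    IsClosed {τ : Matrix (α × β) (α × β) ℂ | IsSeparable τ} := by
  refine (isCompact_convexHull_of_isCompact ?_).isClosed
  convert ((isCompact_setOf_isState α).prod (isCompact_setOf_isState β)).image
    (f := fun p => p.1 ⊗ₖ p.2) ?_ using 1
  · ext τ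
    simp only [Set.mem_ofPred_eq, Set.mem_image, Set.mem_prod, Prod.exists]
    exact ⟨fun ⟨a, b, h1, h2, h⟩ => ⟨a, b, ⟨h1, h2⟩, h.symm⟩,
      fun ⟨a, b, ⟨h1, h2⟩, h⟩ => ⟨a, b, h1, h2, h.symm⟩⟩
  · refine continuous_matrix fun i j => ?_
    simp only [Matrix.kroneckerMap_apply]
    fun_prop

/-! ### Entanglement witnesses -/

theorem isState_inv_smul {ι : Type*} [Fintype ι] {M : Matrix ι ι ℂ} (hM : M.PosSemidef) {r : ℝ}
    (hr : 0 < r) (h : M.trace = r) : IsState ((r : ℂ)⁻¹ • M) := by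
  refine ⟨hM.smul (inv_nonneg.mpr (by exact_mod_cast hr.le)), ?_⟩
  rw [Matrix.trace_smul, h, smul_eq_mul, inv_mul_cancel₀]
  exact_mod_cast hr.ne'

theorem sum_normSq_pos {ι : Type*} [Fintype ι] {u : ι → ℂ} (hu : u ≠ 0) :
    0 < ∑ i, ‖u i‖ ^ 2 := by
  obtain ⟨i, hi⟩ := Function.ne_iff.mp hu
  exact Finset.sum_pos' (fun _ _ => by positivity)
    ⟨i, Finset.mem_univ i, by have := norm_pos_iff.mpr hi; positivity⟩

/-- A strict entanglement witness, written with the bilinear pairing `∑ K x y * ρ x y`. -/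
theorem exists_witness {α β : Type*} [Fintype α] [Fintype β]
    {ρ : Matrix (α × β) (α × β) ℂ} (hρ : IsEntangled ρ) :
    ∃ K : Matrix (α × β) (α × β) ℂ, K.IsHermitian ∧ (∑ x, ∑ y, K x y * ρ x y).re < 0 ∧
      ∀ (u : α → ℂ) (v : β → ℂ), u ≠ 0 → v ≠ 0 →
        0 < (∑ x, ∑ y, K x y * (star (u x.1) * u y.1 * (v x.2 * star (v y.2)))).re := by
  classical
  have : LocallyConvexSpace ℝ (Matrix (α × β) (α × β) ℂ) :=
    inferInstanceAs (LocallyConvexSpace ℝ ((α × β) → (α × β) → ℂ))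
  obtain ⟨f, c, hfρ, hf⟩ := RCLike.geometric_hahn_banach_point_closed (𝕜 := ℂ)
    (convex_convexHull ℝ _) (isClosed_setOf_isSeparable α β) hρ.2
  -- Subtracting `c` times the identity moves the separating threshold to zero on trace-one
  -- matrices.
  let K₀ : Matrix (α × β) (α × β) ℂ :=
    Matrix.of fun x y => f (Matrix.single x y 1) - if x = y then (c : ℂ) else 0
  have hK₀ : ∀ M : Matrix (α × β) (α × β) ℂ,
      ∑ x, ∑ y, K₀ x y * M x y = f M - c * M.trace := by
    intro M
    conv_rhs => rw [Matrix.matrix_eq_sum_single M]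
    simp only [map_sum, K₀, Matrix.of_apply, sub_mul, Finset.sum_sub_distrib, Matrix.trace,
      Matrix.diag, ite_mul, zero_mul, Finset.sum_ite_eq, Finset.mem_univ, if_true]
    congr 1
    · refine Finset.sum_congr rfl fun x _ => Finset.sum_congr rfl fun y _ => ?_
      have : Matrix.single x y (M x y) = M x y • Matrix.single x y (1 : ℂ) := by
        simp [Matrix.smul_single]
      rw [this, map_smul, smul_eq_mul, mul_comm]
    · rw [← Matrix.matrix_eq_sum_single M, Finset.mul_sum]
  -- The Hermitian part pairs with a Hermitian matrix as the real part of the pairing with `K₀`.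
  let K : Matrix (α × β) (α × β) ℂ := (1 / 2 : ℂ) • (K₀ + K₀.conjTranspose)
  have hK : ∀ M : Matrix (α × β) (α × β) ℂ, M.IsHermitian →
      (∑ x, ∑ y, K x y * M x y).re = (f M).re - c * M.trace.re := by
    intro M hM
    have h1 : ∑ x, ∑ y, K x y * M x y
        = (1 / 2) * (∑ x, ∑ y, K₀ x y * M x y + star (∑ x, ∑ y, K₀ x y * M x y)) := by
      conv_rhs => rw [star_sum]; simp only [star_sum]; rw [Finset.sum_comm (f := fun x y => star _)]
      simp only [K, Matrix.smul_apply, Matrix.add_apply, Matrix.conjTranspose_apply,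
        Finset.mul_sum, ← Finset.sum_add_distrib, smul_eq_mul]
      refine Finset.sum_congr rfl fun x _ => Finset.sum_congr rfl fun y _ => ?_
      rw [star_mul', hM.apply]; ring
    rw [h1, hK₀]
    simp [Complex.mul_re]
    ring
  refine ⟨K, ?_, ?_, ?_⟩
  · simp [K, Matrix.IsHermitian, Matrix.conjTranspose_smul, add_comm]
  · rw [hK ρ hρ.1.1.isHermitian, hρ.1.2]
    simpa using hfρ
  · intro u v hu hv
    have hu' := sum_normSq_pos hu
    have hv' := sum_normSq_pos hv
    set U := ∑ i, ‖u i‖ ^ 2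
    set V := ∑ i, ‖v i‖ ^ 2
    let a : Matrix α α ℂ := Matrix.vecMulVec (star u) u
    let b : Matrix β β ℂ := Matrix.vecMulVec v (star v)
    have ha : a.PosSemidef := Matrix.posSemidef_vecMulVec_star_self u
    have hb : b.PosSemidef := Matrix.posSemidef_vecMulVec_self_star v
    have hat : a.trace = U := by
      simp [a, U, Matrix.trace, Matrix.vecMulVec_apply, mul_comm, Complex.mul_conj,
        Complex.normSq_eq_norm_sq]
    have hbt : b.trace = V := by
      simp [b, V, Matrix.trace, Matrix.vecMulVec_apply, Complex.mul_conj,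
        Complex.normSq_eq_norm_sq]
    have h1 := hf _ (subset_convexHull ℝ _
      ⟨_, _, isState_inv_smul ha hu' hat, isState_inv_smul hb hv' hbt, rfl⟩)
    have h2 : ∑ x : α × β, ∑ y : α × β,
        K x y * (star (u x.1) * u y.1 * (v x.2 * star (v y.2))) =
        ∑ x, ∑ y, K x y * (a ⊗ₖ b) x y := rfl
    rw [h2, hK _ (ha.kronecker hb).isHermitian, Matrix.trace_kronecker, hat, hbt]
    rw [Matrix.smul_kronecker, Matrix.kronecker_smul, f.map_smul, f.map_smul] at h1
    have h3 : RCLike.re ((U : ℂ)⁻¹ • (V : ℂ)⁻¹ • f (a ⊗ₖ b)) = (f (a ⊗ₖ b)).re / (U * V) := by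
      rw [← Complex.ofReal_inv, ← Complex.ofReal_inv, smul_eq_mul, smul_eq_mul, RCLike.re_to_complex,
        Complex.re_ofReal_mul, Complex.re_ofReal_mul]
      field_simp
    rw [h3, lt_div_iff₀ (by positivity)] at h1
    rw [← Complex.ofReal_mul, Complex.ofReal_re]
    linarith

/-! ### Positivity for large λ -/

/-- A compactness criterion for nonnegativity of `lam * f + g` on a closed cone. -/
theorem exists_forall_mul_add_nonneg {E : Type*} [NormedAddCommGroup E] [NormedSpace ℝ E]
    [ProperSpace E] {C : Set E} (hC : IsClosed C) (hCs : ∀ (r : ℝ), ∀ q ∈ C, r • q ∈ C)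
    {f g : E → ℝ} (hf : Continuous f) (hg : Continuous g)
    (hf2 : ∀ (r : ℝ) q, f (r • q) = r ^ 2 * f q) (hg2 : ∀ (r : ℝ) q, g (r • q) = r ^ 2 * g q)
    (hf0 : ∀ q, 0 ≤ f q) (hpos : ∀ q ∈ C, q ≠ 0 → f q = 0 → 0 < g q) :
    ∃ L : ℝ, ∀ lam ≥ L, ∀ q ∈ C, 0 ≤ lam * f q + g q := by
  -- Only unit vectors with `g ≤ 0` can cause trouble; there `f` has no zero, so `-g / f` is
  -- bounded.
  have hT : IsCompact (Metric.sphere (0 : E) 1 ∩ (C ∩ {q | g q ≤ 0})) :=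
    (isCompact_sphere _ _).inter_right (hC.inter (isClosed_le hg continuous_const))
  have hfT : ∀ q ∈ Metric.sphere (0 : E) 1 ∩ (C ∩ {q | g q ≤ 0}), f q ≠ 0 := by
    rintro q ⟨hq1, hqC, hqg⟩ h0
    have hq : q ≠ 0 := by
      rintro rfl
      simp at hq1
    exact absurd (hpos q hqC hq h0) (not_lt.mpr hqg)
  obtain ⟨L, hL⟩ := hT.bddAbove_image (f := fun q => -g q / f q)
    (hg.neg.continuousOn.div hf.continuousOn hfT)
  refine ⟨max L 0, fun lam hlam q hq => ?_⟩
  have hlamL : L ≤ lam := (le_max_left _ _).trans hlam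
  have hlam0 : 0 ≤ lam := (le_max_right _ _).trans hlam
  have key : ∀ q ∈ C, ‖q‖ = 1 → 0 ≤ lam * f q + g q := by
    intro q hq hq1
    rcases le_or_gt (g q) 0 with h | h
    · have hmem : q ∈ Metric.sphere (0 : E) 1 ∩ (C ∩ {q | g q ≤ 0}) := ⟨by simpa using hq1, hq, h⟩
      have h1 : -g q / f q ≤ L := hL ⟨q, hmem, rfl⟩
      rw [div_le_iff₀ ((hf0 q).lt_of_ne' (hfT q hmem))] at h1
      nlinarith [hf0 q]
    · have := mul_nonneg hlam0 (hf0 q)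
      linarith
  rcases eq_or_ne q 0 with rfl | hq0
  · have h1 := hf2 0 0
    have h2 := hg2 0 0
    simp only [smul_zero] at h1 h2
    rw [h1, h2]; simp
  · have hn : ‖q‖ ≠ 0 := norm_ne_zero_iff.mpr hq0
    have h1 := key (‖q‖⁻¹ • q) (hCs _ q hq) (by rw [norm_smul]; simp [hn])
    rw [hf2, hg2] at h1
    have h2 : lam * f q + g q
        = ‖q‖ ^ 2 * (lam * (‖q‖⁻¹ ^ 2 * f q) + ‖q‖⁻¹ ^ 2 * g q) := by field_simp
    rw [h2]; positivity

theorem exists_posSemidef_smul_one_sub {ι : Type*} [Fintype ι] [DecidableEq ι]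
    {K : Matrix ι ι ℂ} (hK : K.IsHermitian) :
    ∃ L : ℝ, ∀ lam ≥ L, ((lam : ℂ) • (1 : Matrix ι ι ℂ) - K).PosSemidef := by
  obtain ⟨L, hL⟩ := exists_forall_mul_add_nonneg (E := ι → ℂ) (C := Set.univ) isClosed_univ
    (fun _ _ _ => trivial) (f := fun x => ∑ i, ‖x i‖ ^ 2)
    (g := fun x => -(star x ⬝ᵥ K.mulVec x).re) (by fun_prop)
    (by simp only [dotProduct, Matrix.mulVec]; fun_prop)
    (fun r q => by simp [mul_pow, Finset.mul_sum])
    (fun r q => by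
      simp [Matrix.mulVec_smul, dotProduct_smul, star_smul, smul_dotProduct, pow_two, mul_assoc])
    (fun q => by positivity)
    (fun q _ hq h => absurd h (sum_normSq_pos hq).ne')
  refine ⟨L, fun lam hlam => ?_⟩
  have hH : ((lam : ℂ) • (1 : Matrix ι ι ℂ) - K).IsHermitian := by
    refine Matrix.IsHermitian.sub ?_ hK
    simp [Matrix.IsHermitian, Matrix.conjTranspose_smul]
  refine Matrix.PosSemidef.of_dotProduct_mulVec_nonneg hH fun x => ?_
  rw [Complex.nonneg_iff]
  refine ⟨?_, ?_⟩
  · have h1 := hL lam hlam x trivial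
    have h2 : star x ⬝ᵥ x = ((∑ i, ‖x i‖ ^ 2 : ℝ) : ℂ) := by
      simp [dotProduct, Complex.conj_mul']
    rw [Matrix.sub_mulVec, Matrix.smul_mulVec, Matrix.one_mulVec, dotProduct_sub, dotProduct_smul,
      h2, smul_eq_mul, ← Complex.ofReal_mul, Complex.sub_re, Complex.ofReal_re]
    linarith
  · exact (hH.im_star_dotProduct_mulVec_self x).symm

/-! ### The gap form and the companion operator -/

noncomputable section

/-- The `2 × 2` determinants of the rows of `A` with the conjugated rows of `B`. -/
def cross {α β : Type*} (A : Matrix α (Fin 2) ℂ) (B : Matrix β (Fin 2) ℂ) : Matrix α β ℂ :=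
  Matrix.of fun a b => A a 0 * star (B b 1) - A a 1 * star (B b 0)

/-- For `q = cross A B` this is the trace minus twice the `phi2`-overlap of the filtered operator,
see `gap_cross`. -/
def gap {α β : Type*} [Fintype α] [Fintype β] (M : Matrix (α × β) (α × β) ℂ)
    (q : Matrix α β ℂ) : ℂ :=
  ∑ x, ∑ y, M x y * (q y.1 x.2 * star (q x.1 y.2))

/-- All `3 × 3` minors vanish. -/
def MinorsVanish {α β : Type*} (q : Matrix α β ℂ) : Prop :=
  ∀ (r : Fin 3 → α) (c : Fin 3 → β), (q.submatrix r c).det = 0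

theorem minorsVanish_cross {α β : Type*} (A : Matrix α (Fin 2) ℂ) (B : Matrix β (Fin 2) ℂ) :
    MinorsVanish (cross A B) := by
  intro r c
  simp only [Matrix.det_fin_three, Matrix.submatrix_apply, cross, Matrix.of_apply]
  ring

/-- Antisymmetry in the qubits makes `q` a Kronecker product of a matrix t with an invertible 2 × 2
block, so its rank is twice that of t. Rank at most two then forces t to have rank one. -/
theorem exists_product_of_minorsVanish {α β : Type*} {q : Matrix (α × Fin 2) (β × Fin 2) ℂ}
    (hq : MinorsVanish q) (h0 : q ≠ 0)
    (hs : ∀ a b o p, q (a, o) (b, p) + q (a, p) (b, o) = 0) :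
    ∃ (u : α → ℂ) (v : β → ℂ), u ≠ 0 ∧ v ≠ 0 ∧ ∀ a b, q (a, 0) (b, 1) = u a * v b := by
  have hdiag : ∀ a b o, q (a, o) (b, o) = 0 := fun a b o => by
    have := hs a b o o
    rwa [← two_mul, mul_eq_zero, or_iff_right two_ne_zero] at this
  have hanti : ∀ a b, q (a, 1) (b, 0) = -q (a, 0) (b, 1) := fun a b =>
    eq_neg_of_add_eq_zero_left (hs a b 1 0)
  obtain ⟨a₀, b₀, ht⟩ : ∃ a b, q (a, 0) (b, 1) ≠ 0 := by
    by_contra! h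
    apply h0
    ext ⟨a, o⟩ ⟨b, p⟩
    fin_cases o <;> fin_cases p <;> simp [hdiag, hanti, h]
  refine ⟨fun a => q (a, 0) (b₀, 1), fun b => q (a₀, 0) (b, 1) / q (a₀, 0) (b₀, 1),
    Function.ne_iff.mpr ⟨a₀, ht⟩, Function.ne_iff.mpr ⟨b₀, by simp [ht]⟩, fun a b => ?_⟩
  -- This minor is the nonzero entry t(a₀, b₀) times the 2 × 2 minor of t on rows a₀, a and columns
  -- b₀, b.
  have h := hq ![(a₀, 0), (a₀, 1), (a, 0)] ![(b₀, 0), (b₀, 1), (b, 1)]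
  simp only [Matrix.det_fin_three, Matrix.submatrix_apply, Matrix.cons_val, hdiag, hanti] at h
  field_simp
  have : q (a₀, 0) (b₀, 1) *
      (q (a, 0) (b, 1) * q (a₀, 0) (b₀, 1) - q (a, 0) (b₀, 1) * q (a₀, 0) (b, 1)) = 0 := by
    linear_combination h
  exact sub_eq_zero.mp ((mul_eq_zero.mp this).resolve_left ht)

theorem gap_joint {α β α' β' : Type*} [Fintype α] [Fintype β] [Fintype α'] [Fintype β']
    (L : Matrix (α × β) (α × β) ℂ) (Z : Matrix (α' × β') (α' × β') ℂ)
    (q : Matrix (α × α') (β × β') ℂ) :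
    gap (joint L Z) q = ∑ x, ∑ y, L x y * ∑ z, ∑ w,
      Z z w * (q (y.1, w.1) (x.2, z.2) * star (q (x.1, z.1) (y.2, w.2))) := by
  have e : ∀ F : (α × α') × (β × β') → ℂ,
      ∑ X, F X = ∑ x : α × β, ∑ z : α' × β', F ((x.1, z.1), (x.2, z.2)) := by
    intro F
    rw [← (Equiv.prodProdProdComm α β α' β').sum_comp, Fintype.sum_prod_type]
    rfl
  simp only [gap, e]
  refine Finset.sum_congr rfl fun x _ => ?_
  rw [Finset.sum_comm]
  refine Finset.sum_congr rfl fun y _ => ?_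
  rw [Finset.mul_sum]
  refine Finset.sum_congr rfl fun z _ => ?_
  rw [Finset.mul_sum]
  refine Finset.sum_congr rfl fun w _ => ?_
  exact mul_assoc (L x y) (Z z w) _

theorem gap_add {α β : Type*} [Fintype α] [Fintype β] (M N : Matrix (α × β) (α × β) ℂ)
    (q : Matrix α β ℂ) : gap (M + N) q = gap M q + gap N q := by
  simp [gap, add_mul, Finset.sum_add_distrib]

theorem gap_smul {α β : Type*} [Fintype α] [Fintype β] (c : ℂ) (M : Matrix (α × β) (α × β) ℂ)
    (q : Matrix α β ℂ) : gap (c • M) q = c * gap M q := by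
  simp [gap, Finset.mul_sum, mul_assoc]

/-- The unnormalized companion state of an entangled state with witness `K`. -/
def companion {α β : Type*} [Fintype α] [Fintype β] [DecidableEq α] [DecidableEq β]
    (K : Matrix (α × β) (α × β) ℂ) (lam : ℝ) :
    Matrix ((α × Fin 2) × (β × Fin 2)) ((α × Fin 2) × (β × Fin 2)) ℂ :=
  joint ((lam : ℂ) • 1) (1 - phi2) + joint ((3 : ℂ) • ((lam : ℂ) • 1 - K)) phi2

/-- The qubit factor multiplying λ is (1 - φ₂) + 3φ₂ = 1 + 2φ₂, whose partial transpose 1 + swap is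
twice the projection onto the symmetric subspace; this gives the sum of squares. -/
theorem re_gap_companion {α β : Type*} [Fintype α] [Fintype β] [DecidableEq α] [DecidableEq β]
    (K : Matrix (α × β) (α × β) ℂ) (lam : ℝ) (q : Matrix (α × Fin 2) (β × Fin 2) ℂ) :
    (gap (companion K lam) q).re =
      lam * ∑ a, ∑ b, ∑ o, ∑ p, ‖q (a, o) (b, p) + q (a, p) (b, o)‖ ^ 2 / 2
      + -(3 / 2) * (∑ x, ∑ y, K x y *
        ∑ o, ∑ p, q (y.1, p) (x.2, o) * star (q (x.1, o) (y.2, p))).re := by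
  have hphi : ∀ x y : α × β, ∑ z, ∑ w,
      phi2 z w * (q (y.1, w.1) (x.2, z.2) * star (q (x.1, z.1) (y.2, w.2)))
      = (1 / 2) * ∑ o, ∑ p, q (y.1, p) (x.2, o) * star (q (x.1, o) (y.2, p)) := by
    intro x y
    simp [phi2, Fintype.sum_prod_type, Fin.sum_univ_two]
    ring
  have hone : ∀ x y : α × β, ∑ z, ∑ w,
      (1 - phi2) z w * (q (y.1, w.1) (x.2, z.2) * star (q (x.1, z.1) (y.2, w.2)))
      = ∑ o, ∑ p, q (y.1, o) (x.2, p) * star (q (x.1, o) (y.2, p))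
        - (1 / 2) * ∑ o, ∑ p, q (y.1, p) (x.2, o) * star (q (x.1, o) (y.2, p)) := by
    intro x y
    rw [← hphi]
    simp only [Matrix.sub_apply, sub_mul, Finset.sum_sub_distrib]
    congr 1
    simp [Matrix.one_apply, Fintype.sum_prod_type, Fin.sum_univ_two]
  have hsq : ∀ a b, ((∑ o, ∑ p, q (a, o) (b, p) * star (q (a, o) (b, p))).re +
      (∑ o, ∑ p, q (a, p) (b, o) * star (q (a, o) (b, p))).re) =
      ∑ o, ∑ p, ‖q (a, o) (b, p) + q (a, p) (b, o)‖ ^ 2 / 2 := by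
    intro a b
    simp only [Fin.sum_univ_two, ← Complex.normSq_eq_norm_sq, Complex.normSq_apply,
      Complex.add_re, Complex.add_im, Complex.mul_re, RCLike.star_def, Complex.conj_re,
      Complex.conj_im]
    ring
  rw [companion, gap_add, gap_joint, gap_joint]
  simp only [hphi, hone]
  have h1 : ∀ F : α × β → α × β → ℂ,
      ∑ x, ∑ y, ((lam : ℂ) • (1 : Matrix (α × β) (α × β) ℂ)) x y * F x y = lam * ∑ x, F x x := by
    intro F
    simp [Matrix.one_apply, Finset.mul_sum]
  have h2 : ∀ F : α × β → α × β → ℂ,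
      ∑ x, ∑ y, ((3 : ℂ) • ((lam : ℂ) • (1 : Matrix (α × β) (α × β) ℂ) - K)) x y * (1 / 2 * F x y)
      = (3 / 2 : ℝ) * (lam * ∑ x, F x x) - (3 / 2 : ℝ) * ∑ x, ∑ y, K x y * F x y := by
    intro F
    rw [← h1]
    simp only [Finset.mul_sum, ← Finset.sum_sub_distrib]
    refine Finset.sum_congr rfl fun x _ => Finset.sum_congr rfl fun y _ => ?_
    simp only [Matrix.smul_apply, Matrix.sub_apply, smul_eq_mul]
    push_cast; ring
  rw [h1, h2, Complex.add_re, Complex.sub_re]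
  simp only [Complex.re_ofReal_mul, Finset.sum_sub_distrib, ← Finset.mul_sum, Complex.sub_re,
    Complex.re_sum, ← hsq, Fintype.sum_prod_type, Finset.sum_add_distrib]
  have h3 : ∀ z : ℂ, (1 / 2 * z).re = 1 / 2 * z.re := by intro z; simp
  rw [h3]
  simp only [Complex.re_sum]
  ring

/-- The compactness criterion on the closed cone of matrices of rank at most two. On the zeros of
the λ-term the swap acts as -1, which reverses the sign of -K and makes strict positivity on product
vectors applicable. -/
theorem exists_companion_gap_nonneg {α β : Type*} [Fintype α] [Fintype β] [DecidableEq α]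
    [DecidableEq β] {K : Matrix (α × β) (α × β) ℂ}
    (hK : ∀ (u : α → ℂ) (v : β → ℂ), u ≠ 0 → v ≠ 0 →
      0 < (∑ x, ∑ y, K x y * (star (u x.1) * u y.1 * (v x.2 * star (v y.2)))).re) :
    ∃ L : ℝ, ∀ lam ≥ L, ∀ q, MinorsVanish q → 0 ≤ (gap (companion K lam) q).re := by
  obtain ⟨L, hL⟩ := exists_forall_mul_add_nonneg (E := α × Fin 2 → β × Fin 2 → ℂ)
    (C := {q | MinorsVanish (Matrix.of q)})
    (f := fun q => ∑ a, ∑ b, ∑ o, ∑ p, ‖q (a, o) (b, p) + q (a, p) (b, o)‖ ^ 2 / 2)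
    (g := fun q => -(3 / 2) * (∑ x, ∑ y, K x y *
        ∑ o, ∑ p, q (y.1, p) (x.2, o) * star (q (x.1, o) (y.2, p))).re)
    (by
      simp only [MinorsVanish, Set.ofPred_forall]
      refine isClosed_iInter fun r => isClosed_iInter fun c => isClosed_eq ?_ continuous_const
      refine Continuous.matrix_det (continuous_matrix fun i j => ?_)
      simp only [Matrix.submatrix_apply, Matrix.of_apply]
      fun_prop)
    (by
      intro s q hq r c
      have h1 : (Matrix.of (s • q)).submatrix r c = s • (Matrix.of q).submatrix r c := rfl
      rw [h1, Matrix.det_smul_of_tower, hq r c, smul_zero])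
    (by fun_prop) (by fun_prop)
    (fun r q => by
      simp only [Finset.mul_sum, Pi.smul_apply, ← smul_add, norm_smul, mul_pow, Real.norm_eq_abs,
        sq_abs, mul_div_assoc])
    (fun r q => by
      have : ∀ x y : α × β, ∑ o, ∑ p, (r • q) (y.1, p) (x.2, o) * star ((r • q) (x.1, o) (y.2, p))
          = ((r ^ 2 : ℝ) : ℂ) * ∑ o, ∑ p, q (y.1, p) (x.2, o) * star (q (x.1, o) (y.2, p)) := by
        intro x y
        simp only [Finset.mul_sum, Pi.smul_apply, Complex.real_smul, star_mul', RCLike.star_def,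
          Complex.conj_ofReal]
        refine Finset.sum_congr rfl fun _ _ => Finset.sum_congr rfl fun _ _ => ?_
        push_cast; ring
      simp only [this, mul_left_comm (K _ _), ← Finset.mul_sum, Complex.re_ofReal_mul]
      ring)
    (fun q => by positivity)
    (by
      intro q hq hq0 hf
      have hs : ∀ a b o p, q (a, o) (b, p) + q (a, p) (b, o) = 0 := by
        intro a b o p
        have hf := (Finset.sum_eq_zero_iff_of_nonneg fun _ _ => by positivity).mp hf a
          (Finset.mem_univ _)
        have hf := (Finset.sum_eq_zero_iff_of_nonneg fun _ _ => by positivity).mp hf b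
          (Finset.mem_univ _)
        have hf := (Finset.sum_eq_zero_iff_of_nonneg fun _ _ => by positivity).mp hf o
          (Finset.mem_univ _)
        have hf := (Finset.sum_eq_zero_iff_of_nonneg fun _ _ => by positivity).mp hf p
          (Finset.mem_univ _)
        simpa using hf
      obtain ⟨u, v, hu, hv, huv⟩ := exists_product_of_minorsVanish hq hq0 hs
      simp only [Matrix.of_apply] at huv
      have hdiag : ∀ a b o, q (a, o) (b, o) = 0 := fun a b o => by
        have := hs a b o o
        rwa [← two_mul, mul_eq_zero, or_iff_right two_ne_zero] at this
      have hanti : ∀ a b, q (a, 1) (b, 0) = -(u a * v b) := fun a b => by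
        rw [← huv]
        exact eq_neg_of_add_eq_zero_left (hs a b 1 0)
      have h1 : ∀ x y : α × β, K x y *
          ∑ o, ∑ p, q (y.1, p) (x.2, o) * star (q (x.1, o) (y.2, p))
          = ((-2 : ℝ) : ℂ) * (K x y * (star (u x.1) * u y.1 * (v x.2 * star (v y.2)))) := by
        intro x y
        simp only [Fin.sum_univ_two, hdiag, hanti, huv, star_neg, star_mul', star_zero]
        push_cast; ring
      simp only [h1, ← Finset.mul_sum, Complex.re_ofReal_mul]
      linarith [hK u v hu hv])
  refine ⟨L, fun lam hlam q hq => ?_⟩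
  rw [re_gap_companion]
  exact hL lam hlam q hq

end

/-! ### The singlet fraction in terms of the gap -/

theorem conjTranspose_phi2 : phi2.conjTranspose = phi2 := by
  ext x y
  simp only [phi2, Matrix.conjTranspose_apply, Matrix.of_apply, and_comm]
  split_ifs <;> simp

theorem phi2_mul_phi2 : phi2 * phi2 = phi2 := by
  ext x y
  simp only [phi2, Matrix.mul_apply, Matrix.of_apply, Fintype.sum_prod_type, Fin.sum_univ_two]
  by_cases hx : x.1 = x.2 <;> by_cases hy : y.1 = y.2 <;> simp [hx, hy]
  norm_num

theorem posSemidef_of_isProjection {ι : Type*} [Fintype ι] {P : Matrix ι ι ℂ}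
    (h1 : P.conjTranspose = P) (h2 : P * P = P) : P.PosSemidef := by
  have := Matrix.posSemidef_conjTranspose_mul_self P
  rwa [h1, h2] at this

theorem trace_mul_projection_nonneg {ι : Type*} [Fintype ι] {P X : Matrix ι ι ℂ}
    (hX : X.PosSemidef) (h1 : P.conjTranspose = P) (h2 : P * P = P) : 0 ≤ (X * P).trace.re := by
  have h3 := (hX.mul_mul_conjTranspose_same P).trace_nonneg
  rw [h1, Matrix.mul_assoc, Matrix.trace_mul_comm, Matrix.mul_assoc, h2] at h3
  exact (Complex.le_def.mp h3).1

theorem conjTranspose_one_sub_phi2 : (1 - phi2).conjTranspose = 1 - phi2 := by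
  rw [Matrix.conjTranspose_sub, conjTranspose_phi2, Matrix.conjTranspose_one]

theorem one_sub_phi2_mul_self : (1 - phi2) * (1 - phi2) = 1 - phi2 := by
  simp [mul_sub, sub_mul, phi2_mul_phi2]

variable {α β : Type*} [Fintype α] [Fintype β]

theorem posSemidef_filtered {σ : Matrix (α × β) (α × β) ℂ} (hσ : σ.PosSemidef)
    (A : Matrix α (Fin 2) ℂ) (B : Matrix β (Fin 2) ℂ) : (filtered σ A B).PosSemidef :=
  hσ.conjTranspose_mul_mul_same _

theorem overlap_le_trace {σ : Matrix (α × β) (α × β) ℂ} (hσ : σ.PosSemidef)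
    (A : Matrix α (Fin 2) ℂ) (B : Matrix β (Fin 2) ℂ) :
    (filtered σ A B * phi2).trace.re ≤ (filtered σ A B).trace.re := by
  have := trace_mul_projection_nonneg (posSemidef_filtered hσ A B) conjTranspose_one_sub_phi2
    one_sub_phi2_mul_self
  rw [mul_sub, mul_one, Matrix.trace_sub, Complex.sub_re] at this
  linarith

theorem filtered_apply (M : Matrix (α × β) (α × β) ℂ) (A : Matrix α (Fin 2) ℂ)
    (B : Matrix β (Fin 2) ℂ) (i j : Fin 2 × Fin 2) :
    filtered M A B i j = ∑ x, ∑ y, M x y *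
      (star (A x.1 i.1 * B x.2 i.2) * (A y.1 j.1 * B y.2 j.2)) := by
  rw [filtered, Matrix.mul_apply]
  simp only [Matrix.mul_apply, Finset.sum_mul, Matrix.conjTranspose_apply,
    Matrix.kroneckerMap_apply]
  rw [Finset.sum_comm]
  refine Finset.sum_congr rfl fun x _ => Finset.sum_congr rfl fun y _ => ?_
  ring

theorem gap_cross (M : Matrix (α × β) (α × β) ℂ) (A : Matrix α (Fin 2) ℂ)
    (B : Matrix β (Fin 2) ℂ) :
    gap M (cross A B) = (filtered M A B).trace - 2 * (filtered M A B * phi2).trace := by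
  have h1 : (filtered M A B).trace - 2 * (filtered M A B * phi2).trace =
      filtered M A B (0, 1) (0, 1) + filtered M A B (1, 0) (1, 0)
        - filtered M A B (0, 0) (1, 1) - filtered M A B (1, 1) (0, 0) := by
    simp [Matrix.trace, Matrix.mul_apply, phi2, Fintype.sum_prod_type, Fin.sum_univ_two]
    ring
  rw [h1]
  simp only [filtered_apply, gap, ← Finset.sum_add_distrib, ← Finset.sum_sub_distrib]
  refine Finset.sum_congr rfl fun x _ => Finset.sum_congr rfl fun y _ => ?_
  simp only [cross, Matrix.of_apply, star_sub, star_mul', star_star]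
  ring

theorem bddAbove_F2 {σ : Matrix (α × β) (α × β) ℂ} (hσ : σ.PosSemidef) :
    BddAbove {r : ℝ | ∃ (A : Matrix α (Fin 2) ℂ) (B : Matrix β (Fin 2) ℂ),
      0 < (filtered σ A B).trace.re ∧
        r = (filtered σ A B * phi2).trace.re / (filtered σ A B).trace.re} := by
  refine ⟨1, ?_⟩
  rintro r ⟨A, B, h0, rfl⟩
  exact div_le_one_of_le₀ (overlap_le_trace hσ A B) h0.le

theorem half_lt_F2 {σ : Matrix (α × β) (α × β) ℂ} (hσ : σ.PosSemidef)
    {A : Matrix α (Fin 2) ℂ} {B : Matrix β (Fin 2) ℂ} (h : (gap σ (cross A B)).re < 0) :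
    1 / 2 < F2 σ := by
  have h1 := overlap_le_trace hσ A B
  have h2 : 0 ≤ (filtered σ A B).trace.re :=
    (Complex.le_def.mp (posSemidef_filtered hσ A B).trace_nonneg).1
  have h3 : (filtered σ A B).trace.re < 2 * (filtered σ A B * phi2).trace.re := by
    rw [gap_cross] at h
    simpa using h
  -- The overlap is at most the trace, so trace < 2 · overlap already forces a nonzero denominator.
  have h4 : 0 < (filtered σ A B).trace.re := by linarith
  refine lt_of_lt_of_le ?_ (le_csSup (bddAbove_F2 hσ) ⟨A, B, h4, rfl⟩)
  rw [lt_div_iff₀ h4]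
  linarith

theorem F2_eq_half [DecidableEq α] [DecidableEq β] {σ : Matrix (α × β) (α × β) ℂ}
    (hσ : IsState σ)
    (h : ∀ (A : Matrix α (Fin 2) ℂ) (B : Matrix β (Fin 2) ℂ), 0 ≤ (gap σ (cross A B)).re) :
    F2 σ = 1 / 2 := by
  obtain ⟨x, hx⟩ : ∃ x, 0 < (σ x x).re := by
    by_contra! hc
    have h1 : (σ.trace).re ≤ 0 := by
      rw [Matrix.trace, Complex.re_sum]
      exact Finset.sum_nonpos fun x _ => hc x
    rw [hσ.2] at h1
    norm_num at h1
  have hmem : (1 / 2 : ℝ) ∈ {r : ℝ | ∃ (A : Matrix α (Fin 2) ℂ) (B : Matrix β (Fin 2) ℂ),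
      0 < (filtered σ A B).trace.re ∧
        r = (filtered σ A B * phi2).trace.re / (filtered σ A B).trace.re} := by
    -- The value 1/2 is always attained: filters of rank one onto a basis vector of positive weight
    -- output a multiple of |00⟩⟨00|, whose overlap ratio is 1/2.
    let A : Matrix α (Fin 2) ℂ := Matrix.single x.1 0 1
    let B : Matrix β (Fin 2) ℂ := Matrix.single x.2 0 1
    have hf : ∀ i j, filtered σ A B i j = if i = (0, 0) ∧ j = (0, 0) then σ x x else 0 := by
      intro i j
      rw [filtered_apply, Fintype.sum_eq_single x, Fintype.sum_eq_single x]
      · obtain ⟨i₁, i₂⟩ := i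
        obtain ⟨j₁, j₂⟩ := j
        fin_cases i₁ <;> fin_cases i₂ <;> fin_cases j₁ <;> fin_cases j₂ <;>
          simp [A, B]
      · intro y hy
        rcases not_and_or.mp (mt Prod.ext_iff.mpr hy.symm) with h | h <;>
          simp [A, B, Matrix.single_apply, h]
      · intro y hy
        refine Finset.sum_eq_zero fun z _ => ?_
        rcases not_and_or.mp (mt Prod.ext_iff.mpr hy.symm) with h | h <;>
          simp [A, B, Matrix.single_apply, h]
    have ht : (filtered σ A B).trace = σ x x := by
      simp [Matrix.trace, hf]
    have hp : (filtered σ A B * phi2).trace = ((1 / 2 : ℝ) : ℂ) * σ x x := by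
      simp [Matrix.trace, Matrix.mul_apply, hf, phi2, Fintype.sum_prod_type]
      ring
    refine ⟨A, B, by rwa [ht], ?_⟩
    rw [ht, hp, Complex.re_ofReal_mul]
    field_simp
  refine le_antisymm (csSup_le ⟨_, hmem⟩ ?_) (le_csSup (bddAbove_F2 hσ.1) hmem)
  rintro r ⟨A, B, h0, rfl⟩
  have h1 := h A B
  rw [gap_cross] at h1
  simp only [Complex.sub_re, Complex.mul_re, Complex.re_ofNat, Complex.im_ofNat, zero_mul,
    sub_zero] at h1
  rw [div_le_iff₀ h0]
  linarith

/-! ### Symmetric extensions to k copies -/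

noncomputable section

/-- The conjugation of `S` with the linear map sending the basis vector `g` to `e g`. -/
def push {γ δ : Type*} [Fintype γ] [DecidableEq δ] (e : γ → δ) (S : Matrix γ γ ℂ) :
    Matrix δ δ ℂ :=
  Matrix.of fun x y => ∑ g, ∑ g', if x = e g ∧ y = e g' then S g g' else 0

theorem posSemidef_push {γ δ : Type*} [Fintype γ] [Finite δ] [DecidableEq δ] (e : γ → δ)
    {S : Matrix γ γ ℂ} (hS : S.PosSemidef) : (push e S).PosSemidef := by
  have := Fintype.ofFinite δ
  let V : Matrix δ γ ℂ := Matrix.of fun x g => if x = e g then 1 else 0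
  convert hS.mul_mul_conjTranspose_same V
  ext x y
  simp only [push, Matrix.of_apply, Matrix.mul_apply, V, Matrix.conjTranspose_apply,
    Finset.sum_mul]
  rw [Finset.sum_comm]
  refine Finset.sum_congr rfl fun g' _ => Finset.sum_congr rfl fun g _ => ?_
  by_cases h1 : x = e g <;> by_cases h2 : y = e g' <;> simp [h1, h2]

theorem sum_push_mul {γ δ : Type*} [Fintype γ] [Fintype δ] [DecidableEq δ] (e : γ → δ)
    (S : Matrix γ γ ℂ) (h : δ → δ → ℂ) :
    ∑ x, ∑ y, push e S x y * h x y = ∑ g, ∑ g', S g g' * h (e g) (e g') := by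
  have h1 : ∀ x y, push e S x y * h x y
      = ∑ g, ∑ g', if x = e g then (if y = e g' then S g g' * h x y else 0) else 0 := by
    intro x y
    simp only [push, Matrix.of_apply, Finset.sum_mul, ite_and, ite_mul, zero_mul]
  simp only [h1]
  calc _ = ∑ x, ∑ g, ∑ g', ∑ y, if x = e g then (if y = e g' then S g g' * h x y else 0) else 0 := by
        refine Finset.sum_congr rfl fun x _ => ?_
        rw [Finset.sum_comm]
        exact Finset.sum_congr rfl fun g _ => Finset.sum_comm
    _ = ∑ g, ∑ g', ∑ x, ∑ y, if x = e g then (if y = e g' then S g g' * h x y else 0) else 0 := by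
        rw [Finset.sum_comm]
        exact Finset.sum_congr rfl fun g _ => Finset.sum_comm
    _ = _ := by
        refine Finset.sum_congr rfl fun g _ => Finset.sum_congr rfl fun g' _ => ?_
        rw [Fintype.sum_eq_single (e g) (fun x hx => by simp [hx]),
          Fintype.sum_eq_single (e g') (fun x hx => by simp [hx])]
        simp

theorem trace_push {γ δ : Type*} [Fintype γ] [Fintype δ] [DecidableEq δ] {e : γ → δ}
    (he : Function.Injective e) (S : Matrix γ γ ℂ) : (push e S).trace = S.trace := by
  classical
  have h1 := sum_push_mul e S fun x y => if x = y then 1 else 0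
  simpa [he.eq_iff, Matrix.trace] using h1

/-- Place `g` at copy `m` and `c` at all the other copies. -/
def atCopy {γ : Type*} {k : ℕ} (c : γ) (m : Fin k) (g : γ) : Fin k → γ :=
  Function.update (fun _ => c) m g

theorem injective_atCopy {γ : Type*} {k : ℕ} (c : γ) (m : Fin k) :
    Function.Injective (atCopy c m) :=
  fun g g' h => by simpa [atCopy] using congrFun h m

/-- The permutation-symmetrized tensor product of `S` with `k - 1` copies of the basis state
`|c⟩⟨c|`. -/
def symExtension {γ : Type*} [Fintype γ] [DecidableEq γ] (k : ℕ) (c : γ) (S : Matrix γ γ ℂ) :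
    Matrix (Fin k → γ) (Fin k → γ) ℂ :=
  (k : ℂ)⁻¹ • ∑ m, push (atCopy c m) S

section symExtension

variable {γ : Type*} [Fintype γ] [DecidableEq γ] {k : ℕ} (c : γ) (S : Matrix γ γ ℂ)

theorem isState_symExtension [NeZero k] {S : Matrix γ γ ℂ} (hS : IsState S) :
    IsState (symExtension k c S) := by
  refine ⟨Matrix.PosSemidef.smul (Matrix.posSemidef_sum _ fun m _ => posSemidef_push _ hS.1) ?_, ?_⟩
  · exact inv_nonneg.mpr (by exact_mod_cast k.zero_le)
  · simp [symExtension, Matrix.trace_smul, Matrix.trace_sum, trace_push (injective_atCopy _ _),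
      hS.2, NeZero.ne k]

theorem isPermSymmetric_symExtension : IsPermSymmetric (symExtension k c S) := by
  intro π
  have hx : ∀ (x : Fin k → γ) m g, x ∘ π = atCopy c m g ↔ x = atCopy c (π m) g := by
    intro x m g
    rw [← Equiv.eq_comp_symm]
    have : atCopy c m g ∘ π.symm = atCopy c (π m) g := by
      simp only [atCopy]
      rw [Function.update_comp_equiv]
      simp [Function.comp_def]
    rw [this]
  ext x y
  simp only [symExtension, Matrix.submatrix_apply, Matrix.smul_apply, Matrix.sum_apply, push,
    Matrix.of_apply, hx]
  congr 1
  exact Equiv.sum_comp π fun m => ∑ g, ∑ g', if x = atCopy c m g ∧ y = atCopy c m g' then S g g' else 0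

theorem reduceTo_push_self (m : Fin k) : reduceTo m (push (atCopy c m) S) = S := by
  ext i j
  have h1 : ∀ (z : {l : Fin k // l ≠ m} → γ) i g,
      (Equiv.funSplitAt m γ).symm (i, z) = atCopy c m g ↔ i = g ∧ z = fun _ => c := by
    intro z i g
    rw [Equiv.symm_apply_eq, Prod.ext_iff]
    refine and_congr ?_ ?_
    · simp [atCopy]
    · refine Eq.congr_right ?_
      ext l
      simp [atCopy, l.2]
  simp only [reduceTo, push, Matrix.of_apply, h1]
  rw [Fintype.sum_eq_single (fun _ => c) (fun z hz => by simp [hz]),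
    Fintype.sum_eq_single i (fun g hg => by simp [hg.symm]),
    Fintype.sum_eq_single j (fun g hg => by simp [hg.symm])]
  simp

theorem reduceTo_push_of_ne {m n : Fin k} (hmn : n ≠ m) :
    reduceTo m (push (atCopy c n) S) = S.trace • Matrix.single c c 1 := by
  ext i j
  have h1 : ∀ (z : {l : Fin k // l ≠ m} → γ) i g,
      (Equiv.funSplitAt m γ).symm (i, z) = atCopy c n g ↔
        i = c ∧ z = fun l => atCopy c n g l.1 := by
    intro z i g
    rw [Equiv.symm_apply_eq, Prod.ext_iff]
    simp [atCopy, hmn.symm, funext_iff]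
  have h2 : ∀ g g' : γ, ((fun l : {l : Fin k // l ≠ m} => atCopy c n g l.1)
      = fun l => atCopy c n g' l.1) ↔ g = g' := by
    intro g g'
    refine ⟨fun h => ?_, fun h => by rw [h]⟩
    simpa [atCopy] using congrFun h ⟨n, hmn⟩
  simp only [reduceTo, push, Matrix.of_apply, h1]
  rw [Finset.sum_comm]
  have h3 : ∀ g, (∑ z : {l : Fin k // l ≠ m} → γ, ∑ g',
      if (i = c ∧ z = fun l => atCopy c n g l.1) ∧ (j = c ∧ z = fun l => atCopy c n g' l.1)
      then S g g' else 0) = if i = c ∧ j = c then S g g else 0 := by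
    intro g
    rw [Fintype.sum_eq_single (fun l => atCopy c n g l.1) (fun z hz => by simp [hz]),
      Fintype.sum_eq_single g (fun g' hg => by simp [h2, hg.symm])]
    simp
  simp only [h3, Matrix.smul_apply, Matrix.single_apply, Matrix.trace, Matrix.diag]
  simp only [eq_comm (a := c)]
  by_cases hi : i = c <;> by_cases hj : j = c <;> simp [hi, hj]

theorem reduceTo_symExtension [NeZero k] {S : Matrix γ γ ℂ} (hS : S.trace = 1) (m : Fin k) :
    reduceTo m (symExtension k c S)
      = (k : ℂ)⁻¹ • (S + ((k - 1 : ℕ) : ℂ) • Matrix.single c c 1) := by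
  have h1 : reduceTo m (symExtension k c S)
      = (k : ℂ)⁻¹ • ∑ n, reduceTo m (push (atCopy c n) S) := by
    ext i j
    simp only [reduceTo, symExtension, Matrix.of_apply, Matrix.smul_apply, Matrix.sum_apply,
      smul_eq_mul, ← Finset.mul_sum]
    rw [Finset.sum_comm]
  rw [h1, ← Finset.add_sum_erase _ _ (Finset.mem_univ m), reduceTo_push_self,
    Finset.sum_congr rfl fun n hn => reduceTo_push_of_ne c S (Finset.ne_of_mem_erase hn), hS]
  simp [Finset.card_erase_of_mem, ← Nat.cast_smul_eq_nsmul ℂ]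

end symExtension

theorem gap_asBipartite {α β : Type*} [Fintype α] [Fintype β] {k : ℕ}
    (ω : Matrix (Fin k → α × β) (Fin k → α × β) ℂ) (q : Matrix (Fin k → α) (Fin k → β) ℂ) :
    gap (asBipartite ω) q = ∑ x, ∑ y, ω x y *
      (q (fun l => (y l).1) (fun l => (x l).2) * star (q (fun l => (x l).1) (fun l => (y l).2))) := by
  let e := Equiv.arrowProdEquivProdArrow (Fin k) (fun _ => α) (fun _ => β)
  rw [gap, ← e.sum_comp]
  refine Finset.sum_congr rfl fun x _ => ?_
  rw [← e.sum_comp]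
  refine Finset.sum_congr rfl fun y _ => ?_
  have : asBipartite ω (e x) (e y) = ω x y := by
    change ω (e.symm (e x)) (e.symm (e y)) = _
    rw [e.symm_apply_apply, e.symm_apply_apply]
  rw [this]
  rfl

/-- Since c = (c.1, c.2) is a product basis state, fixing all copies but one restricts each party's
filter separately, and the restricted pair is again a local filter. -/
theorem gap_asBipartite_symExtension [DecidableEq α] [DecidableEq β] {k : ℕ} (c : α × β)
    (S : Matrix (α × β) (α × β) ℂ) (A : Matrix (Fin k → α) (Fin 2) ℂ)
    (B : Matrix (Fin k → β) (Fin 2) ℂ) :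
    gap (asBipartite (symExtension k c S)) (cross A B) = (k : ℂ)⁻¹ * ∑ m,
      gap S (cross (A.submatrix (atCopy c.1 m) id) (B.submatrix (atCopy c.2 m) id)) := by
  have h1 : ∀ (m : Fin k) (g : α × β), (fun l => (atCopy c m g l).1) = atCopy c.1 m g.1 := by
    intro m g
    ext l
    by_cases h : l = m
    · subst h; simp [atCopy]
    · simp [atCopy, h]
  have h2 : ∀ (m : Fin k) (g : α × β), (fun l => (atCopy c m g l).2) = atCopy c.2 m g.2 := by
    intro m g
    ext l
    by_cases h : l = m
    · subst h; simp [atCopy]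
    · simp [atCopy, h]
  rw [gap_asBipartite]
  simp only [symExtension, Matrix.smul_apply, smul_eq_mul, mul_assoc, ← Finset.mul_sum,
    Matrix.sum_apply, Finset.sum_mul]
  congr 1
  rw [Finset.sum_congr rfl fun x _ => Finset.sum_comm, Finset.sum_comm]
  refine Finset.sum_congr rfl fun m _ => ?_
  refine (sum_push_mul (atCopy c m) S fun x y : Fin k → α × β =>
    cross A B (fun l => (y l).1) (fun l => (x l).2) *
      star (cross A B (fun l => (x l).1) (fun l => (y l).2))).trans ?_
  simp only [h1, h2]
  rfl

theorem isCopyCorrelatedUndistillable_of_gap_nonneg [DecidableEq α] [DecidableEq β] (k : ℕ)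
    [NeZero k] (c : α × β) {S : Matrix (α × β) (α × β) ℂ} (hS : IsState S)
    (h : ∀ (A : Matrix α (Fin 2) ℂ) (B : Matrix β (Fin 2) ℂ), 0 ≤ (gap S (cross A B)).re) :
    IsCopyCorrelatedUndistillable k
      ((k : ℂ)⁻¹ • (S + ((k - 1 : ℕ) : ℂ) • Matrix.single c c 1)) := by
  have hω := isState_symExtension (k := k) c hS
  refine ⟨⟨?_, ?_⟩, symExtension k c S, hω, isPermSymmetric_symExtension c S, ?_,
    reduceTo_symExtension c hS.2 0⟩
  · refine Matrix.PosSemidef.smul (hS.1.add (Matrix.PosSemidef.smul ?_ (Nat.cast_nonneg _)))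
      (inv_nonneg.mpr (Nat.cast_nonneg _))
    rw [← Matrix.diagonal_single]
    exact Matrix.PosSemidef.diagonal (Pi.single_nonneg.mpr zero_le_one)
  · rw [Matrix.trace_smul, Matrix.trace_add, Matrix.trace_smul, hS.2, Matrix.trace_single_eq_same,
      Nat.cast_sub NeZero.one_le]
    simp [NeZero.ne k]
  · refine F2_eq_half ⟨?_, ?_⟩ fun A B => ?_
    · exact (Matrix.posSemidef_submatrix_equiv _).mpr hω.1
    · rw [← hω.2, asBipartite, Matrix.reindex_apply, Matrix.trace, Matrix.trace]
      exact Equiv.sum_comp (Equiv.arrowProdEquivProdArrow (Fin k) (fun _ => α) (fun _ => β)).symm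
        fun x => symExtension k c S x x
    · rw [gap_asBipartite_symExtension, ← Complex.ofReal_natCast, ← Complex.ofReal_inv,
        Complex.re_ofReal_mul, Complex.re_sum]
      exact mul_nonneg (by positivity) (Finset.sum_nonneg fun m _ => h _ _)

/-! ### Activating ρ with the companion -/

theorem posSemidef_joint {α' β' : Type*} [Fintype α'] [Fintype β']
    {ρ : Matrix (α × β) (α × β) ℂ} {σ : Matrix (α' × β') (α' × β') ℂ} (hρ : ρ.PosSemidef)
    (hσ : σ.PosSemidef) : (joint ρ σ).PosSemidef :=
  (Matrix.posSemidef_submatrix_equiv _).mpr (hρ.kronecker hσ)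

theorem posSemidef_companion [DecidableEq α] [DecidableEq β] {K : Matrix (α × β) (α × β) ℂ}
    {lam : ℝ} (h0 : 0 ≤ lam) (h : ((lam : ℂ) • (1 : Matrix (α × β) (α × β) ℂ) - K).PosSemidef) :
    (companion K lam).PosSemidef := by
  refine (posSemidef_joint (Matrix.PosSemidef.one.smul (by exact_mod_cast h0)) ?_).add
    (posSemidef_joint (h.smul (by norm_num)) ?_)
  · exact posSemidef_of_isProjection conjTranspose_one_sub_phi2 one_sub_phi2_mul_self
  · exact posSemidef_of_isProjection conjTranspose_phi2 phi2_mul_phi2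

/-- The projection of the systems `α`, `α` onto the maximally entangled vector, which leaves a
qubit. -/
def entanglingFilter (α : Type*) [DecidableEq α] : Matrix (α × (α × Fin 2)) (Fin 2) ℂ :=
  Matrix.of fun a j => if a.1 = a.2.1 ∧ a.2.2 = j then 1 else 0

/-- The antisymmetric form on qubit indices. -/
def symplectic (o p : Fin 2) : ℂ := (p.val : ℂ) - (o.val : ℂ)

theorem cross_entanglingFilter {α β : Type*} [DecidableEq α] [DecidableEq β] (a : α × (α × Fin 2))
    (b : β × (β × Fin 2)) :
    cross (entanglingFilter α) (entanglingFilter β) a b =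
      if a.1 = a.2.1 then if b.1 = b.2.1 then symplectic a.2.2 b.2.2 else 0 else 0 := by
  obtain ⟨a₁, a₂, o⟩ := a
  obtain ⟨b₁, b₂, p⟩ := b
  by_cases h1 : a₁ = a₂ <;> by_cases h2 : b₁ = b₂ <;> fin_cases o <;> fin_cases p <;>
    simp [cross, entanglingFilter, symplectic, h1, h2]

theorem gap_joint_entanglingFilter [DecidableEq α] [DecidableEq β]
    (ρ : Matrix (α × β) (α × β) ℂ)
    (σ : Matrix ((α × Fin 2) × (β × Fin 2)) ((α × Fin 2) × (β × Fin 2)) ℂ) :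
    gap (joint ρ σ) (cross (entanglingFilter α) (entanglingFilter β)) =
      ∑ x, ∑ y, ρ x y * ∑ z : Fin 2 × Fin 2, ∑ w : Fin 2 × Fin 2,
        σ ((x.1, z.1), (x.2, z.2)) ((y.1, w.1), (y.2, w.2)) *
          (symplectic w.1 z.2 * star (symplectic z.1 w.2)) := by
  have h : ∀ (x : α × β) (F : (α × Fin 2) × (β × Fin 2) → ℂ),
      ∑ X, (if x.1 = X.1.1 then if x.2 = X.2.1 then F X else 0 else 0) =
        ∑ z : Fin 2 × Fin 2, F ((x.1, z.1), (x.2, z.2)) := by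
    intro x F
    simp only [Fintype.sum_prod_type]
    rw [Fintype.sum_eq_single x.1 fun a ha => by simp [ha.symm]]
    refine Finset.sum_congr rfl fun o _ => ?_
    rw [Fintype.sum_eq_single x.2 fun b hb => by simp [hb.symm]]
    simp
  rw [gap_joint]
  refine Finset.sum_congr rfl fun x _ => Finset.sum_congr rfl fun y _ => ?_
  congr 1
  refine Eq.trans ?_ (h x fun z => ∑ w : Fin 2 × Fin 2, σ z ((y.1, w.1), (y.2, w.2)) *
    (symplectic w.1 z.2.2 * star (symplectic z.1.2 w.2)))
  refine Finset.sum_congr rfl fun z _ => ?_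
  rw [← h y fun w => σ z w * (symplectic w.1.2 z.2.2 * star (symplectic z.1.2 w.2.2))]
  by_cases h1 : x.1 = z.1.1 <;> by_cases h2 : x.2 = z.2.1 <;>
    simp only [cross_entanglingFilter, h1, h2, if_true, if_false, ite_self, zero_mul, mul_zero,
      star_zero, Finset.sum_const_zero]
  refine Finset.sum_congr rfl fun w _ => ?_
  by_cases h3 : y.1 = w.1.1 <;> by_cases h4 : y.2 = w.2.1 <;> simp [h3, h4]

/-- On the antisymmetric form, of squared norm 2, the partial transposes of 1 - φ₂ and φ₂ take the
values 3 and -1. The factor 3 in `companion` is what makes the λ-terms cancel. -/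
theorem gap_joint_companion [DecidableEq α] [DecidableEq β] (ρ K : Matrix (α × β) (α × β) ℂ)
    (lam : ℝ) :
    gap (joint ρ (companion K lam)) (cross (entanglingFilter α) (entanglingFilter β)) =
      3 * ∑ x, ∑ y, K x y * ρ x y := by
  rw [gap_joint_entanglingFilter, Finset.mul_sum]
  refine Finset.sum_congr rfl fun x _ => ?_
  rw [Finset.mul_sum]
  refine Finset.sum_congr rfl fun y _ => ?_
  have h : ∀ z w : Fin 2 × Fin 2,
      companion K lam ((x.1, z.1), (x.2, z.2)) ((y.1, w.1), (y.2, w.2)) =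
        ((lam : ℂ) • (1 : Matrix (α × β) (α × β) ℂ)) x y * (1 - phi2) z w +
        ((3 : ℂ) • ((lam : ℂ) • (1 : Matrix (α × β) (α × β) ℂ) - K)) x y * phi2 z w :=
    fun z w => rfl
  simp [h, Fintype.sum_prod_type, Fin.sum_univ_two, symplectic, phi2, Matrix.one_apply]
  split_ifs <;> ring

/-- Both qubits are in state 0, where the antisymmetric form vanishes. -/
theorem gap_joint_single [DecidableEq α] [DecidableEq β] (ρ : Matrix (α × β) (α × β) ℂ)
    (a : α) (b : β) :
    gap (joint ρ (Matrix.single ((a, 0), (b, 0)) ((a, 0), (b, 0)) 1))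
      (cross (entanglingFilter α) (entanglingFilter β)) = 0 := by
  rw [gap_joint_entanglingFilter]
  simp [Fintype.sum_prod_type, Fin.sum_univ_two, symplectic, Matrix.single_apply]

theorem joint_smul {α β α' β' : Type*} (ρ : Matrix (α × β) (α × β) ℂ)
    (c : ℂ) (σ : Matrix (α' × β') (α' × β') ℂ) : joint ρ (c • σ) = c • joint ρ σ := by
  simp only [joint, Matrix.kronecker_smul]
  rfl

theorem joint_add {α β α' β' : Type*} (ρ : Matrix (α × β) (α × β) ℂ)
    (σ τ : Matrix (α' × β') (α' × β') ℂ) : joint ρ (σ + τ) = joint ρ σ + joint ρ τ := by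
  simp only [joint, Matrix.kronecker_add]
  rfl

end

end CopyCorr

open CopyCorr in
theorem theorem2 (d : ℕ) (ρ : Matrix (Fin d × Fin d) (Fin d × Fin d) ℂ) (hρ : IsEntangled ρ)
    (k : ℕ) [NeZero k] :
    ∃ σ : Matrix ((Fin d × Fin 2) × (Fin d × Fin 2)) ((Fin d × Fin 2) × (Fin d × Fin 2)) ℂ,
      IsCopyCorrelatedUndistillable k σ ∧ 1 / 2 < F2 (joint ρ σ) := by
  obtain ⟨K, hK, hKρ, hKprod⟩ := exists_witness hρ
  obtain ⟨L₁, hL₁⟩ := exists_posSemidef_smul_one_sub hK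
  obtain ⟨L₂, hL₂⟩ := exists_companion_gap_nonneg hKprod
  let lam := max 0 (max L₁ L₂)
  have hlam0 : 0 ≤ lam := le_max_left _ _
  have hpsd := hL₁ lam ((le_max_left _ _).trans (le_max_right _ _))
  have hgap := hL₂ lam ((le_max_right _ _).trans (le_max_right _ _))
  have hS := posSemidef_companion hlam0 hpsd
  set S := companion K lam with hSdef
  obtain ⟨a, b⟩ : Nonempty (Fin d × Fin d) := by
    by_contra hne
    rw [not_nonempty_iff] at hne
    have := hρ.1.2
    simp [Matrix.trace] at this
  have hneg : (gap (joint ρ S) (cross (entanglingFilter (Fin d)) (entanglingFilter (Fin d)))).re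
      < 0 := by
    rw [hSdef, gap_joint_companion]
    rw [← Complex.ofReal_ofNat, Complex.re_ofReal_mul]
    linarith
  -- A positive semidefinite matrix of trace zero is zero and could not give a negative gap.
  have htr : 0 < S.trace.re := by
    have h0 := Complex.le_def.mp hS.trace_nonneg
    refine lt_of_le_of_ne h0.1 fun h => ?_
    have : S.trace = 0 := Complex.ext h.symm h0.2.symm
    rw [hS.trace_eq_zero_iff] at this
    rw [this] at hneg
    simp [gap, joint] at hneg
  have htr' : S.trace = (S.trace.re : ℂ) :=
    Complex.ext rfl (by simpa using (Complex.le_def.mp hS.trace_nonneg).2.symm)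
  have hstate := isState_inv_smul hS htr htr'
  -- The filler state has both qubits equal to 0, so that `gap_joint_single` removes it from the
  -- joint gap; `a` and `b` are arbitrary.
  have hund := isCopyCorrelatedUndistillable_of_gap_nonneg k ((a, 0), (b, 0)) hstate fun A B => by
    rw [gap_smul, ← Complex.ofReal_inv, Complex.re_ofReal_mul]
    exact mul_nonneg (by positivity) (hgap _ (minorsVanish_cross A B))
  refine ⟨_, hund, half_lt_F2 (posSemidef_joint hρ.1.1 hund.1.1)
    (A := entanglingFilter (Fin d)) (B := entanglingFilter (Fin d)) ?_⟩
  rw [joint_smul, joint_add, joint_smul, joint_smul, gap_smul, gap_add, gap_smul, gap_smul,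
    gap_joint_single, mul_zero, add_zero, ← Complex.ofReal_natCast, ← Complex.ofReal_inv,
    ← Complex.ofReal_inv, Complex.re_ofReal_mul, Complex.re_ofReal_mul]
  have hk : (0 : ℝ) < (k : ℝ)⁻¹ := by
    have := NeZero.pos k
    positivity
  exact mul_neg_of_pos_of_neg hk (mul_neg_of_pos_of_neg (inv_pos.mpr htr) hneg)
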